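/- Let $\mathrm{Homeo}^+(\mathbb R)$ be the group (under composition) of orientation preserving homeomorphisms of $\mathbb R$, and let $\operatorname{supp} f=\{x : f(x)\neq x\}$. Let $n\ge 2$ and let $J_1,\dots,J_n\subseteq\mathbb R$ be nonempty open intervals (possibly unbounded) which form an $n$-chain of intervals: $J_i\cap J_k=\varnothing$ whenever $|i-k|>1$, and for $1\le i\le n-1$ the set $J_i\cap J_{i+1}$ is a nonempty proper subinterval of both $J_i$ and $J_{i+1}$. Assume that the left endpoint of $J_i$ is strictly smaller than the left endpoint of $J_{i+1}$ for every $i<n$. Let $f_1,\dots,f_n\in\mathrm{Homeo}^+(\mathbb R)$ satisfy $\operatorname{supp} f_i=J_i$ and $f_i(t)\ge t$ for all $t\in\mathbb R$ (so that $\langle f_1,\dots,f_n\rangle$ is a prechain group with generators $f_1,\dots,f_n$; it is called a chain group if moreover $\langle f_i,f_{i+1}\rangle\cong F$ for each $1\le i\le n-1$). Here Thompson's group is $F=\langle a,b\rangle\le\mathrm{Homeo}^+(\mathbb R)$, where $a(x)=x+1$, and $b(x)=x$ for $x\le 0$, $b(x)=2x$ for $0<x<1$, $b(x)=x+1$ for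 $x\ge 1$. The Higman–Thompson group $F_n$ is $$F_n=\langle g_0,g_1,g_2,\dots \mid g_i^{-1}g_jg_i=g_{j+n-1}\ \text{ for } 0\le i<j\rangle .$$ Then there is a natural number $N_0$, depending on $f_1,\dots,f_n$, such that for every integer $N\ge N_0$ the group $G_N=\langle f_1^N,\dots,f_n^N\rangle$ is a chain group with generators $f_1^N,\dots,f_n^N$: these satisfy $\operatorname{supp} f_i^N=J_i$ and $f_i^N(t)\ge t$ for all $t$, and $\langle f_i^N,f_{i+1}^N\rangle\cong F$ for each $1\le i\le n-1$. Moreover $G_N\cong F_n$ for every $N\ge N_0$. -/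

import Mathlib

namespace ChainGroup

/-- `Homeo⁺(ℝ)`: the group, under composition, of the orientation preserving (that is, strictly
increasing) self-homeomorphisms of the real line. -/
def HomeoPlus : Subgroup (ℝ ≃ₜ ℝ) where
  carrier := {f | StrictMono f}
  mul_mem' := fun {f g} (hf : StrictMono f) (hg : StrictMono g) => hf.comp hg
  one_mem' := strictMono_id
  inv_mem' := fun {f} (hf : StrictMono f) x y hxy => by
    by_contra hle
    have h := hf.monotone (not_lt.mp hle)
    have e : ∀ z, f (f⁻¹ z) = z := fun z => f.apply_symm_apply z
    rw [e, e] at h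
    exact absurd hxy (not_lt.mpr h)

/-- The support of a homeomorphism: the set of points that it moves (no closure is taken). -/
def supp (f : HomeoPlus) : Set ℝ := {x | f.1 x ≠ x}

/-- The left endpoint `∂⁻J` of an interval `J`, in the extended reals. -/
noncomputable def leftEndpoint (J : Set ℝ) : EReal := sInf ((fun x : ℝ => (x : EReal)) '' J)

/-- `J 0, …, J (n - 1)` is an `n`-chain of intervals: nonempty open subintervals of `ℝ` such that
non-consecutive ones are disjoint, and any two consecutive ones meet in a nonempty proper
subinterval of both. -/
structure IsIntervalChain {n : ℕ} (J : Fin n → Set ℝ) : Prop where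
  nonempty : ∀ i, (J i).Nonempty
  isOpen : ∀ i, IsOpen (J i)
  ordConnected : ∀ i, (J i).OrdConnected
  disjoint : ∀ i k : Fin n, (i : ℕ) + 1 < k → Disjoint (J i) (J k)
  overlap : ∀ i k : Fin n, (i : ℕ) + 1 = k →
    (J i ∩ J k).Nonempty ∧ J i ∩ J k ⊂ J i ∧ J i ∩ J k ⊂ J k

/-- The data of a prechain group: `n ≥ 2`, an `n`-chain of intervals `J i` whose left endpoints
are strictly increasing, and homeomorphisms `f i` with `supp (f i) = J i` that move no point to
the left. -/
structure IsPrechain {n : ℕ} (J : Fin n → Set ℝ) (f : Fin n → HomeoPlus) : Prop where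
  two_le : 2 ≤ n
  chain : IsIntervalChain J
  left_lt : ∀ i k : Fin n, (i : ℕ) + 1 = k → leftEndpoint (J i) < leftEndpoint (J k)
  supp_eq : ∀ i, supp (f i) = J i
  le_apply : ∀ i, ∀ t : ℝ, t ≤ (f i).1 t

/-- The group `⟨f 0, …, f (n - 1)⟩ ≤ Homeo⁺(ℝ)`. -/
def generatedGroup {n : ℕ} (f : Fin n → HomeoPlus) : Subgroup HomeoPlus :=
  Subgroup.closure (Set.range f)

/-- The translation `a(x) = x + 1`. -/
noncomputable def thompsonA : HomeoPlus :=
  ⟨Homeomorph.addRight 1, fun x y (h : x < y) => add_lt_add_left h 1⟩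

/-- The piecewise linear map `b`: `b(x) = x` for `x ≤ 0`, `b(x) = 2x` for `0 < x < 1`,
`b(x) = x + 1` for `1 ≤ x`. -/
noncomputable def bFun (x : ℝ) : ℝ := if x ≤ 0 then x else if x < 1 then 2 * x else x + 1

theorem bFun_strictMono : StrictMono bFun := by
  intro x y h
  unfold bFun
  split_ifs <;> linarith

theorem bFun_rightInverse : Function.RightInverse
    (fun y : ℝ => if y ≤ 0 then y else if y < 2 then y / 2 else y - 1) bFun := by
  intro y
  unfold bFun
  dsimp only
  split_ifs <;> linarith

/-- The map `b` as an element of `Homeo⁺(ℝ)`. -/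
noncomputable def thompsonB : HomeoPlus :=
  ⟨(StrictMono.orderIsoOfRightInverse bFun bFun_strictMono _ bFun_rightInverse).toHomeomorph,
    bFun_strictMono⟩

/-- The standard copy `F = ⟨a, b⟩ ≤ Homeo⁺(ℝ)` of Thompson's group. -/
noncomputable def ThompsonF : Subgroup HomeoPlus := Subgroup.closure {thompsonA, thompsonB}

/-- The relators `(g_i⁻¹ g_j g_i) g_{j+n-1}⁻¹`, for `0 ≤ i < j`, of the Higman–Thompson group
`F_n` (used for `n ≥ 2` only). -/
def higmanThompsonRels (n : ℕ) : Set (FreeGroup ℕ) :=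
  {r | ∃ i j : ℕ, i < j ∧ r = ((FreeGroup.of i)⁻¹ * FreeGroup.of j * FreeGroup.of i) *
    (FreeGroup.of (j + (n - 1)))⁻¹}

/-- The Higman–Thompson group
`F_n = ⟨g_0, g_1, g_2, … | g_i⁻¹ g_j g_i = g_{j+n-1} for 0 ≤ i < j⟩`. -/
abbrev HigmanThompson (n : ℕ) : Type := PresentedGroup (higmanThompsonRels n)

/-- `f 0, …, f (n - 1)`, with supports `J 0, …, J (n - 1)`, are the distinguished generators of an
`n`-chain group: they form a prechain, and any two consecutive ones generate a copy of Thompson's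
group `F`. -/
structure IsChain {n : ℕ} (J : Fin n → Set ℝ) (f : Fin n → HomeoPlus) : Prop
    extends IsPrechain J f where
  adjacent : ∀ i k : Fin n, (i : ℕ) + 1 = k →
    Nonempty (Subgroup.closure {f i, f k} ≃* ThompsonF)

end ChainGroup

namespace ChainGroup

/-! With m = n - 1 and F_i = f_i^N, indexed from 0, put P = F_m ⋯ F_0, h_k = F_m ⋯ F_k for k ≤ m,
and h_{k+m} = P h_k P⁻¹ for k > 0. For large N the product P carries J_1 ∪ … ∪ J_m to the right of
J_0 ∪ … ∪ J_{m-1} (`IsPrechain.eventually_isFast`). This makes enough supports disjoint for h_i h_j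
h_i⁻¹ = h_{j+m} (i < j) to hold, so F_n maps onto ⟨F_0, …, F_m⟩
(`nonempty_closure_image_mulEquiv_higmanThompson`). The map is injective because elements of F_n are
fractions of positive words, the h_i never move points left, and each h_i moves a point fixed by all
later ones: the least letter of a positive word can thus be read off from its image
(`nonempty_closure_mulEquiv_higmanThompson`). Thompson's F is itself a fast 2-prechain, hence F ≅
F_2, and the case n = 2 settles adjacent pairs. -/

theorem mul_val_apply (f g : HomeoPlus) (x : ℝ) : (f * g).1 x = f.1 (g.1 x) := rfl

theorem apply_inv_apply (f : HomeoPlus) (x : ℝ) : f.1 ((f⁻¹).1 x) = x := f.1.apply_symm_apply x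

theorem inv_apply_apply (f : HomeoPlus) (x : ℝ) : (f⁻¹).1 (f.1 x) = x := f.1.symm_apply_apply x

theorem strictMono_val (f : HomeoPlus) : StrictMono f.1 := f.2

theorem HomeoPlus.ext_apply {f g : HomeoPlus} (h : ∀ x, f.1 x = g.1 x) : f = g :=
  Subtype.ext (Homeomorph.ext h)

theorem inv_apply_eq_of_apply_eq {f : HomeoPlus} {x : ℝ} (h : f.1 x = x) : (f⁻¹).1 x = x := by
  conv_lhs => rw [← h]
  exact inv_apply_apply f x

theorem inv_apply_le {f : HomeoPlus} (h : ∀ t, t ≤ f.1 t) (x : ℝ) : (f⁻¹).1 x ≤ x := by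
  simpa only [apply_inv_apply] using h ((f⁻¹).1 x)

/-! ### Positive words in F_n and a faithfulness criterion -/

section Presentation

variable {n : ℕ}

/-- The element of `F_n` represented by a positive word. -/
def positiveWord (n : ℕ) (l : List ℕ) : HigmanThompson n :=
  (l.map (PresentedGroup.of (rels := higmanThompsonRels n))).prod

theorem positiveWord_nil : positiveWord n [] = 1 := rfl

theorem positiveWord_cons (i : ℕ) (l : List ℕ) :
    positiveWord n (i :: l) = PresentedGroup.of i * positiveWord n l := by
  simp [positiveWord]

theorem positiveWord_append (l l' : List ℕ) :
    positiveWord n (l ++ l') = positiveWord n l * positiveWord n l' := by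
  simp [positiveWord]

theorem higmanThompson_of_mul_of {i j : ℕ} (h : i < j) :
    (PresentedGroup.of j : HigmanThompson n) * PresentedGroup.of i =
      PresentedGroup.of i * PresentedGroup.of (j + (n - 1)) := by
  have := PresentedGroup.one_of_mem (rels := higmanThompsonRels n) ⟨i, j, h, rfl⟩
  simp only [map_mul, map_inv] at this
  have h2 := mul_inv_eq_one.1 this
  rw [mul_assoc, inv_mul_eq_iff_eq_mul] at h2
  exact h2

/-- The relations read g_i⁻¹ g_j = g_{j+n-1} g_i⁻¹ for i < j and g_i⁻¹ g_j = g_j g_{i+n-1}⁻¹ for j <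
i, so an inverse letter travels right until it cancels or reaches the end. -/
theorem exists_inv_of_mul_positiveWord (p : List ℕ) (i : ℕ) :
    ∃ p' q' : List ℕ, (PresentedGroup.of i : HigmanThompson n)⁻¹ * positiveWord n p =
      positiveWord n p' * (positiveWord n q')⁻¹ := by
  induction p generalizing i with
  | nil => exact ⟨[], [i], by simp [positiveWord]⟩
  | cons j p ih =>
    rcases lt_trichotomy i j with h | rfl | h
    · obtain ⟨p', q', e⟩ := ih i
      refine ⟨(j + (n - 1)) :: p', q', ?_⟩
      rw [positiveWord_cons, positiveWord_cons, mul_assoc, ← e, ← mul_assoc, ← mul_assoc,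
        inv_mul_eq_iff_eq_mul.2 (by rw [← mul_assoc, ← higmanThompson_of_mul_of h,
          mul_inv_cancel_right] :
          (PresentedGroup.of j : HigmanThompson n) = PresentedGroup.of i *
            (PresentedGroup.of (j + (n - 1)) * (PresentedGroup.of i)⁻¹))]
    · exact ⟨p, [], by simp [positiveWord]⟩
    · obtain ⟨p', q', e⟩ := ih (i + (n - 1))
      refine ⟨j :: p', q', ?_⟩
      rw [positiveWord_cons, positiveWord_cons, mul_assoc, ← e, ← mul_assoc, ← mul_assoc,
        inv_mul_eq_iff_eq_mul.2 (by rw [← mul_assoc, higmanThompson_of_mul_of h,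
          mul_inv_cancel_right] :
          (PresentedGroup.of j : HigmanThompson n) = PresentedGroup.of i *
            (PresentedGroup.of j * (PresentedGroup.of (i + (n - 1)))⁻¹))]

/-- `F_n` is the group of right fractions of its positive monoid. -/
theorem exists_eq_positiveWord_mul_inv (g : HigmanThompson n) :
    ∃ p q : List ℕ, g = positiveWord n p * (positiveWord n q)⁻¹ := by
  have hg : g ∈ Subgroup.closure
      (Set.range (PresentedGroup.of (rels := higmanThompsonRels n))) := by
    rw [PresentedGroup.closure_range_of]; trivial
  induction hg using Subgroup.closure_induction_left with
  | one => exact ⟨[], [], by simp [positiveWord]⟩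
  | mul_left x hx y _ ih =>
    obtain ⟨i, rfl⟩ := hx
    obtain ⟨p, q, rfl⟩ := ih
    exact ⟨i :: p, q, by rw [positiveWord_cons, mul_assoc]⟩
  | inv_mul_cancel x hx y _ ih =>
    obtain ⟨i, rfl⟩ := hx
    obtain ⟨p, q, rfl⟩ := ih
    obtain ⟨p', q', e⟩ := exists_inv_of_mul_positiveWord (n := n) p i
    exact ⟨p', q ++ q', by rw [← mul_assoc, e, positiveWord_append, mul_inv_rev, mul_assoc]⟩

/-- The least letter of a positive word can be moved to the front. -/
theorem positiveWord_extract_min (p : List ℕ) : p = [] ∨ ∃ (i : ℕ) (p' : List ℕ),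
    positiveWord n p = positiveWord n (i :: p') ∧ p'.length + 1 = p.length ∧
      ∀ j ∈ p', i ≤ j := by
  induction p with
  | nil => exact Or.inl rfl
  | cons j p ih =>
    right
    rcases ih with rfl | ⟨i, p', e, hl, hm⟩
    · exact ⟨j, [], rfl, rfl, by simp⟩
    · rcases le_or_gt j i with h | h
      · refine ⟨j, i :: p', by rw [positiveWord_cons, e, ← positiveWord_cons], by simp [hl], ?_⟩
        intro k hk
        rcases List.mem_cons.1 hk with rfl | hk
        · exact h
        · exact h.trans (hm k hk)
      · refine ⟨i, (j + (n - 1)) :: p', ?_, by simp [hl], ?_⟩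
        · rw [positiveWord_cons, e, positiveWord_cons, positiveWord_cons, positiveWord_cons,
            ← mul_assoc, higmanThompson_of_mul_of h, mul_assoc]
        · intro k hk
          rcases List.mem_cons.1 hk with rfl | hk
          · omega
          · exact hm k hk

/-- A family of homeomorphisms satisfying the relations of `F_n`, none of which moves a point to
the left, and such that each moves a point fixed by all later ones, generates a copy of `F_n`. -/
theorem nonempty_closure_mulEquiv_higmanThompson (h : ℕ → HomeoPlus)
    (hrel : ∀ i j, i < j → h i * h j * (h i)⁻¹ = h (j + (n - 1)))
    (hle : ∀ i t, t ≤ (h i).1 t)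
    (hwit : ∀ i, ∃ t, (h i).1 t ≠ t ∧ ∀ j, i < j → (h j).1 t = t) :
    Nonempty (Subgroup.closure (Set.range h) ≃* HigmanThompson n) := by
  -- The generators go to inverses because `hrel` conjugates on the opposite side from the relators.
  have hr : ∀ r ∈ higmanThompsonRels n, FreeGroup.lift (fun i => (h i)⁻¹) r = 1 := by
    rintro r ⟨i, j, hij, rfl⟩
    simp only [map_mul, map_inv, FreeGroup.lift_apply_of, inv_inv, ← hrel i j hij]
    group
  let φ : HigmanThompson n →* HomeoPlus := PresentedGroup.toGroup hr
  have hφ : ∀ i, φ (PresentedGroup.of i) = (h i)⁻¹ := fun i => PresentedGroup.toGroup.of hr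
  have hword_le : ∀ l t, (φ (positiveWord n l)).1 t ≤ t := by
    intro l
    induction l with
    | nil => intro t; rw [positiveWord_nil, map_one]; exact le_rfl
    | cons i l ih =>
      intro t
      rw [positiveWord_cons, map_mul, hφ, mul_val_apply]
      exact (inv_apply_le (hle i) _).trans (ih t)
  have hword_fix : ∀ l t, (∀ j ∈ l, (h j).1 t = t) → (φ (positiveWord n l)).1 t = t := by
    intro l t
    induction l with
    | nil => intro _; rw [positiveWord_nil, map_one]; rfl
    | cons i l ih =>
      intro hl
      rw [positiveWord_cons, map_mul, hφ, mul_val_apply,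
        ih fun j hj => hl j (List.mem_cons_of_mem _ hj)]
      exact inv_apply_eq_of_apply_eq (hl i List.mem_cons_self)
  -- At the witness t of i the image of q is trivial; if that of `i :: p` fixed t too, then h_i(t) =
  -- φ(p)(t) ≤ t, which is impossible.
  have hne : ∀ i p q, (∀ j ∈ q, i < j) →
      φ (positiveWord n (i :: p)) ≠ φ (positiveWord n q) := by
    intro i p q hq e
    obtain ⟨t, ht, hfix⟩ := hwit i
    have h1 := hword_fix q t fun j hj => hfix j (hq j hj)
    rw [← e, positiveWord_cons, map_mul, hφ, mul_val_apply] at h1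
    have h2 := congrArg (h i).1 h1
    rw [apply_inv_apply] at h2
    exact ht (le_antisymm (h2 ▸ hword_le p t) (hle i t))
  -- Distinct least letters are excluded by `hne`; equal ones cancel, so induction on the length of
  -- p alone suffices.
  have hpos : ∀ k p q, p.length = k → φ (positiveWord n p) = φ (positiveWord n q) →
      positiveWord n p = positiveWord n q := by
    intro k
    induction k with
    | zero =>
      intro p q hp e
      obtain rfl := List.length_eq_zero_iff.1 hp
      rcases positiveWord_extract_min (n := n) q with rfl | ⟨i, q', e', _, _⟩
      · rfl
      · exact absurd (e' ▸ e).symm (hne i q' [] (by simp))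
    | succ k ih =>
      intro p q hp e
      rcases positiveWord_extract_min (n := n) p with rfl | ⟨i, p', ep, hpl, hpm⟩
      · simp at hp
      rcases positiveWord_extract_min (n := n) q with rfl | ⟨j, q', eq, hql, hqm⟩
      · exact absurd (ep ▸ e) (hne i p' [] (by simp))
      rw [ep, eq] at e ⊢
      rcases lt_trichotomy i j with hij | rfl | hij
      · refine absurd e (hne i p' _ fun k hk => ?_)
        rcases List.mem_cons.1 hk with rfl | hk
        · exact hij
        · exact hij.trans_le (hqm k hk)
      · rw [positiveWord_cons, positiveWord_cons, map_mul, map_mul] at e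
        rw [positiveWord_cons, positiveWord_cons, ih p' q' (by omega) (mul_left_cancel e)]
      · refine absurd e.symm (hne j q' _ fun k hk => ?_)
        rcases List.mem_cons.1 hk with rfl | hk
        · exact hij
        · exact hij.trans_le (hpm k hk)
  have hinj : Function.Injective φ := by
    rw [injective_iff_map_eq_one]
    intro g hg
    obtain ⟨p, q, rfl⟩ := exists_eq_positiveWord_mul_inv g
    rw [map_mul, map_inv, mul_inv_eq_one] at hg
    rw [mul_inv_eq_one]
    exact hpos _ p q rfl hg
  have hrange : φ.range = Subgroup.closure (Set.range h) := by
    apply le_antisymm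
    · rw [MonoidHom.range_eq_map, ← PresentedGroup.closure_range_of, MonoidHom.map_closure,
        Subgroup.closure_le]
      rintro _ ⟨_, ⟨i, rfl⟩, rfl⟩
      rw [hφ]
      exact inv_mem (Subgroup.subset_closure ⟨i, rfl⟩)
    · rw [Subgroup.closure_le]
      rintro _ ⟨i, rfl⟩
      exact ⟨(PresentedGroup.of i)⁻¹, by rw [map_inv, hφ, inv_inv]⟩
  exact ⟨(MulEquiv.subgroupCongr hrange.symm).trans (MonoidHom.ofInjective hinj).symm⟩

end Presentation

/-! ### Partial products and the candidate generators h_k -/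

section PrefixProducts

/-- The product `F (k - 1) ⋯ F 1 F 0`. -/
def prefixProd (F : ℕ → HomeoPlus) : ℕ → HomeoPlus
  | 0 => 1
  | k + 1 => F k * prefixProd F k

theorem prefixProd_succ (F : ℕ → HomeoPlus) (k : ℕ) :
    prefixProd F (k + 1) = F k * prefixProd F k := rfl

/-- For k ≤ m the quotient `prefixProd F m * (prefixProd F k)⁻¹` is the partial product F (m-1) ⋯ F
k; this recursion drives the inductions on it. -/
theorem prefixProd_mul_inv_succ (F : ℕ → HomeoPlus) (m k : ℕ) :
    prefixProd F (m + 1) * (prefixProd F k)⁻¹ = F m * (prefixProd F m * (prefixProd F k)⁻¹) := by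
  rw [prefixProd, mul_assoc]

theorem le_prefixProd_mul_inv_apply {F : ℕ → HomeoPlus} (hF : ∀ i t, t ≤ (F i).1 t) {k m : ℕ}
    (hkm : k ≤ m) (t : ℝ) : t ≤ (prefixProd F m * (prefixProd F k)⁻¹).1 t := by
  induction m, hkm using Nat.le_induction with
  | base => rw [mul_inv_cancel]; exact le_rfl
  | succ m _ ih =>
    rw [prefixProd_mul_inv_succ, mul_val_apply]
    exact ih.trans (hF m _)

theorem prefixProd_mul_inv_apply_of_fixed {F : ℕ → HomeoPlus} {k m : ℕ} (hkm : k ≤ m) {t : ℝ}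
    (h : ∀ i, k ≤ i → i < m → (F i).1 t = t) :
    (prefixProd F m * (prefixProd F k)⁻¹).1 t = t := by
  induction m, hkm using Nat.le_induction with
  | base => rw [mul_inv_cancel]; rfl
  | succ m hm ih =>
    rw [prefixProd_mul_inv_succ, mul_val_apply, ih fun i h1 h2 => h i h1 (h2.trans m.lt_succ_self)]
    exact h m hm m.lt_succ_self

theorem prefixProd_apply_of_fixed {F : ℕ → HomeoPlus} {m : ℕ} {t : ℝ}
    (h : ∀ i < m, (F i).1 t = t) : (prefixProd F m).1 t = t := by
  simpa [prefixProd] using prefixProd_mul_inv_apply_of_fixed m.zero_le fun i _ hi => h i hi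

theorem lt_prefixProd_mul_inv_apply {F : ℕ → HomeoPlus} (hF : ∀ i t, t ≤ (F i).1 t) {k m : ℕ}
    (hkm : k < m) {t : ℝ} (ht : (F k).1 t ≠ t) :
    t < (prefixProd F m * (prefixProd F k)⁻¹).1 t := by
  induction m, hkm using Nat.le_induction with
  | base =>
    rw [prefixProd_mul_inv_succ, mul_inv_cancel, mul_one]
    exact lt_of_le_of_ne (hF k t) ht.symm
  | succ m _ ih =>
    rw [prefixProd_mul_inv_succ, mul_val_apply]
    exact ih.trans_le (hF m _)

/-- Two homeomorphisms commute when no point is moved by both. -/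
theorem commute_of_forall_fixed {f g : HomeoPlus} (h : ∀ t, f.1 t = t ∨ g.1 t = t) :
    f * g = g * f := by
  apply HomeoPlus.ext_apply
  intro t
  rw [mul_val_apply, mul_val_apply]
  by_cases hg : g.1 t = t
  · rw [hg]
    rcases h (f.1 t) with h' | h'
    · rw [f.1.injective h', hg]
    · rw [h']
  · have hf := (h t).resolve_right hg
    rw [hf]
    exact (h (g.1 t)).resolve_right fun e => hg (g.1.injective e)

/-- The generators of the Higman–Thompson group in terms of those of the chain group:
`F m ⋯ F k` for `k ≤ m`, continued by conjugation with `F m ⋯ F 0`. -/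
def chainGen (F : ℕ → HomeoPlus) (m : ℕ) : ℕ → HomeoPlus
  | 0 => prefixProd F (m + 1)
  | j + 1 => prefixProd F (m + 1) ^ (j / m) *
      (prefixProd F (m + 1) * (prefixProd F (j % m + 1))⁻¹) *
        (prefixProd F (m + 1) ^ (j / m))⁻¹

theorem chainGen_of_le (F : ℕ → HomeoPlus) {m k : ℕ} (hk : k ≤ m) :
    chainGen F m k = prefixProd F (m + 1) * (prefixProd F k)⁻¹ := by
  cases k with
  | zero => simp [chainGen, prefixProd]
  | succ k => simp [chainGen, Nat.div_eq_of_lt hk, Nat.mod_eq_of_lt hk]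

/-- Positivity of k is essential: at k = 0 the identity would read F m = P. Hence `chainGen` divides
the index minus one, with residues standing for 1, …, m. -/
theorem chainGen_add (F : ℕ → HomeoPlus) {m k : ℕ} (hm : 0 < m) (hk : 0 < k) :
    chainGen F m (k + m) =
      prefixProd F (m + 1) * chainGen F m k * (prefixProd F (m + 1))⁻¹ := by
  obtain ⟨k, rfl⟩ := Nat.exists_eq_succ_of_ne_zero hk.ne'
  have : k.succ + m = (k + m) + 1 := by omega
  rw [this, chainGen, chainGen, Nat.add_mod_right, Nat.add_div_right _ hm, pow_succ']
  group

/-- The F k are recovered as h_{k+1}⁻¹ h_k for k < m, and F m = h_m. -/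
theorem closure_range_chainGen (F : ℕ → HomeoPlus) {m : ℕ} (hm : 0 < m) :
    Subgroup.closure (Set.range (chainGen F m)) = Subgroup.closure (F '' Set.Iic m) := by
  apply le_antisymm
  · rw [Subgroup.closure_le]
    have hp : ∀ k ≤ m + 1, prefixProd F k ∈ Subgroup.closure (F '' Set.Iic m) := by
      intro k hk
      induction k with
      | zero => exact one_mem _
      | succ k ih =>
        exact mul_mem (Subgroup.subset_closure ⟨k, by simpa using hk, rfl⟩) (ih (by omega))
    rintro _ ⟨k, rfl⟩
    cases k with
    | zero => exact hp _ le_rfl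
    | succ k =>
      have := Nat.mod_lt k hm
      exact mul_mem (mul_mem (pow_mem (hp _ le_rfl) _)
          (mul_mem (hp _ le_rfl) (inv_mem (hp _ (by omega))))) (inv_mem (pow_mem (hp _ le_rfl) _))
  · rw [Subgroup.closure_le]
    rintro _ ⟨k, hk, rfl⟩
    have hk : k ≤ m := hk
    rcases hk.lt_or_eq with h | rfl
    · have : F k = (chainGen F m (k + 1))⁻¹ * chainGen F m k := by
        rw [chainGen_of_le F h, chainGen_of_le F hk, prefixProd_succ F k]
        group
      rw [this]
      exact mul_mem (inv_mem (Subgroup.subset_closure ⟨_, rfl⟩)) (Subgroup.subset_closure ⟨_, rfl⟩)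
    · have : F k = chainGen F k k := by
        rw [chainGen_of_le F le_rfl, prefixProd_succ F k, mul_inv_cancel_right]
      rw [this]
      exact Subgroup.subset_closure ⟨_, rfl⟩

end PrefixProducts

/-! ### Supports of the h_k and the relations of F_n -/

section ChainGenerators

variable {F : ℕ → HomeoPlus} {m : ℕ}

theorem chainGen_conj_moved (hm : 0 < m) {j : ℕ} (hj : m < j) {y : ℝ}
    (hy : (chainGen F m j).1 y ≠ y) :
    ∃ z, y = (prefixProd F (m + 1)).1 z ∧ (chainGen F m (j - m)).1 z ≠ z := by
  refine ⟨((prefixProd F (m + 1))⁻¹).1 y, (apply_inv_apply _ _).symm, fun e => hy ?_⟩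
  have hjm : j = (j - m) + m := by omega
  rw [hjm, chainGen_add F hm (by omega), mul_val_apply, mul_val_apply, e, apply_inv_apply]

/-- For j > m the support of h_j is the P-image of that of h_{j-m}, which inductively lies in the
supports of F 1, …, F m; by `hC` this image misses those of F 0, …, F (m-1). -/
theorem chainGen_moved (hm : 0 < m)
    (hC : ∀ i < m, ∀ j, 0 < j → j ≤ m → ∀ x y, (F i).1 x ≠ x → (F j).1 y ≠ y →
      x < (prefixProd F (m + 1)).1 y)
    (j : ℕ) (hj : 0 < j) {y : ℝ} (hy : (chainGen F m j).1 y ≠ y) :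
    (∃ k, 0 < k ∧ k ≤ m ∧ (F k).1 y ≠ y) ∧ (m < j → ∀ i < m, (F i).1 y = y) := by
  induction j using Nat.strong_induction_on generalizing y with
  | _ j ih =>
    rcases le_or_gt j m with hjm | hjm
    · refine ⟨?_, fun h => absurd h (not_lt.2 hjm)⟩
      by_contra! hno
      apply hy
      rw [chainGen_of_le F hjm]
      exact prefixProd_mul_inv_apply_of_fixed (by omega)
        fun i h1 h2 => hno i (by omega) (by omega)
    · obtain ⟨z, rfl, hz⟩ := chainGen_conj_moved hm hjm hy
      obtain ⟨⟨k, hk0, hkm, hk⟩, -⟩ := ih (j - m) (by omega) (by omega) hz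
      have hfix : ∀ i < m, (F i).1 ((prefixProd F (m + 1)).1 z) = (prefixProd F (m + 1)).1 z := by
        intro i hi
        by_contra hne
        exact lt_irrefl _ (hC i hi k hk0 hkm _ _ hne hk)
      -- If F m fixed P z, so would every factor of P; injectivity gives P z = z, so F k would fix
      -- z.
      refine ⟨⟨m, hm, le_rfl, fun e => ?_⟩, fun _ => hfix⟩
      have hP : (prefixProd F (m + 1)).1 ((prefixProd F (m + 1)).1 z) =
          (prefixProd F (m + 1)).1 z := prefixProd_apply_of_fixed fun i hi => by
        rcases (Nat.lt_succ_iff.1 hi).lt_or_eq with h | rfl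
        · exact hfix i h
        · exact e
      have hz' := (prefixProd F (m + 1)).1.injective hP
      rw [hz'] at hfix e
      rcases hkm.lt_or_eq with h | rfl
      · exact hk (hfix k h)
      · exact hk e

/-- A chain of homeomorphisms whose total product `F m ⋯ F 0` moves every point of the supports
of `F 1, …, F m` beyond the supports of `F 0, …, F (m - 1)` generates a copy of `F_{m+1}`. -/
theorem nonempty_closure_image_mulEquiv_higmanThompson (hm : 0 < m)
    (hle : ∀ i t, t ≤ (F i).1 t)
    (hdisj : ∀ i k, i + 1 < k → k ≤ m → ∀ t, (F i).1 t ≠ t → (F k).1 t = t)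
    (hproper : ∀ i < m, ∃ t, (F i).1 t ≠ t ∧ (F (i + 1)).1 t = t)
    (hmeet : ∃ t, (F m).1 t ≠ t ∧ (F (m - 1)).1 t ≠ t)
    (hC : ∀ i < m, ∀ j, 0 < j → j ≤ m → ∀ x y, (F i).1 x ≠ x → (F j).1 y ≠ y →
      x < (prefixProd F (m + 1)).1 y) :
    Nonempty (Subgroup.closure (F '' Set.Iic m) ≃* HigmanThompson (m + 1)) := by
  rw [← closure_range_chainGen F hm]
  have hfix : ∀ j, m < j → ∀ i < m, ∀ x, (F i).1 x ≠ x → (chainGen F m j).1 x = x := by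
    intro j hj i hi x hx
    by_contra hne
    exact hx ((chainGen_moved hm hC j (by omega) hne).2 hj i hi)
  have hsub : ∀ j, m < j → ∃ j', 0 < j' ∧ j' < j ∧ j = j' + m :=
    fun j hj => ⟨j - m, by omega, by omega, by omega⟩
  apply nonempty_closure_mulEquiv_higmanThompson
  · intro i
    rw [Nat.add_sub_cancel]
    induction i using Nat.strong_induction_on with
    | _ i ih =>
      intro j hij
      rcases le_or_gt i m with him | him
      -- Since P = h_i · `prefixProd F i` and the second factor commutes with h_j, conjugation by
      -- h_i acts on h_j as conjugation by P, which is the shift by m.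
      · have hcomm : prefixProd F i * chainGen F m j = chainGen F m j * prefixProd F i := by
          apply commute_of_forall_fixed
          intro t
          by_cases hall : ∀ k < i, (F k).1 t = t
          · exact Or.inl (prefixProd_apply_of_fixed hall)
          · right
            push Not at hall
            obtain ⟨k, hki, hk⟩ := hall
            rcases le_or_gt j m with hjm | hjm
            · rw [chainGen_of_le F hjm]
              exact prefixProd_mul_inv_apply_of_fixed (by omega)
                fun l h1 h2 => hdisj k l (by omega) (by omega) t hk
            · exact hfix j hjm k (by omega) t hk
        have hP : prefixProd F (m + 1) = chainGen F m i * prefixProd F i := by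
          rw [chainGen_of_le F him, inv_mul_cancel_right]
        rw [chainGen_add F hm (by omega), hP, mul_assoc (chainGen F m i) (prefixProd F i), hcomm]
        group
      -- Here both indices exceed m, and the relation is the P-conjugate of an earlier one.
      · obtain ⟨i', hi0, hi', rfl⟩ := hsub i him
        obtain ⟨j', hj0, hj', rfl⟩ := hsub j (by omega)
        have := ih i' hi' j' (by omega)
        have hi := chainGen_add F hm hi0
        have hj := chainGen_add F hm hj0
        rw [chainGen_add F hm (by omega : 0 < j' + m), hi]
        nth_rw 1 [hj]
        rw [← this]
        group
  · intro i
    induction i using Nat.strong_induction_on with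
    | _ i ih =>
      intro t
      rcases le_or_gt i m with him | him
      · rw [chainGen_of_le F him]
        exact le_prefixProd_mul_inv_apply hle (by omega) t
      · obtain ⟨i', hi0, hi', rfl⟩ := hsub i him
        rw [chainGen_add F hm hi0, mul_val_apply, mul_val_apply]
        conv_lhs => rw [← apply_inv_apply (prefixProd F (m + 1)) t]
        exact (strictMono_val _).monotone (ih i' hi' _)
  · intro i
    induction i using Nat.strong_induction_on with
    | _ i ih =>
      -- Witnesses: a point of J_i outside J_{i+1} for i < m, a point of J_{m-1} ∩ J_m for i = m,
      -- and P-images of earlier witnesses beyond.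
      rcases lt_trichotomy i m with him | rfl | him
      · obtain ⟨t, ht, ht'⟩ := hproper i him
        refine ⟨t, ?_, fun j hij => ?_⟩
        · rw [chainGen_of_le F him.le]
          exact (lt_prefixProd_mul_inv_apply hle (by omega) ht).ne'
        · rcases le_or_gt j m with hjm | hjm
          · rw [chainGen_of_le F hjm]
            refine prefixProd_mul_inv_apply_of_fixed (by omega) fun l h1 h2 => ?_
            rcases (by omega : l = i + 1 ∨ i + 1 < l) with rfl | h
            · exact ht'
            · exact hdisj i l h (by omega) t ht
          · exact hfix j hjm i him t ht
      · obtain ⟨t, ht, ht'⟩ := hmeet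
        refine ⟨t, ?_, fun j hij => hfix j hij (i - 1) (by omega) t ht'⟩
        rw [chainGen_of_le F le_rfl]
        exact (lt_prefixProd_mul_inv_apply hle (by omega) ht).ne'
      · obtain ⟨i', hi0, hi', rfl⟩ := hsub i him
        obtain ⟨t, ht, ht'⟩ := ih i' hi'
        refine ⟨(prefixProd F (m + 1)).1 t, fun e => ht ?_, fun j hij => ?_⟩
        · rw [chainGen_add F hm hi0, mul_val_apply, mul_val_apply, inv_apply_apply] at e
          exact (prefixProd F (m + 1)).1.injective e
        · obtain ⟨j', hj0, hj', rfl⟩ := hsub j (by omega)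
          rw [chainGen_add F hm hj0, mul_val_apply, mul_val_apply, inv_apply_apply,
            ht' j' (by omega)]

end ChainGenerators

/-! ### From interval chains to the dynamical hypotheses -/

section Prechain

/-- The extension of a finite family of homeomorphisms by the identity. -/
def extendOne {n : ℕ} (f : Fin n → HomeoPlus) (k : ℕ) : HomeoPlus :=
  if h : k < n then f ⟨k, h⟩ else 1

theorem extendOne_of_lt {n : ℕ} (f : Fin n → HomeoPlus) {k : ℕ} (h : k < n) :
    extendOne f k = f ⟨k, h⟩ := dif_pos h

theorem extendOne_image {m : ℕ} (f : Fin (m + 1) → HomeoPlus) :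
    extendOne f '' Set.Iic m = Set.range f := by
  ext g
  constructor
  · rintro ⟨k, hk, rfl⟩
    rw [extendOne_of_lt f (Nat.lt_succ_of_le hk)]
    exact ⟨_, rfl⟩
  · rintro ⟨i, rfl⟩
    exact ⟨i, Nat.le_of_lt_succ i.2, extendOne_of_lt f i.2⟩

theorem le_extendOne_apply {n : ℕ} {f : Fin n → HomeoPlus} (hf : ∀ i t, t ≤ (f i).1 t)
    (k : ℕ) (t : ℝ) : t ≤ (extendOne f k).1 t := by
  unfold extendOne
  split_ifs with h
  · exact hf _ t
  · exact le_rfl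

/-- The total product `f (n - 1) ⋯ f 0` moves every point of `J 1, …, J (n - 1)` beyond
`J 0, …, J (n - 2)`. -/
def IsFast {n : ℕ} (J : Fin n → Set ℝ) (f : Fin n → HomeoPlus) : Prop :=
  ∀ i j : Fin n, (i : ℕ) + 1 < n → 0 < (j : ℕ) → ∀ x ∈ J i, ∀ y ∈ J j,
    x < (prefixProd (extendOne f) n).1 y

variable {n : ℕ} {J : Fin n → Set ℝ} {f : Fin n → HomeoPlus}

theorem IsPrechain.apply_ne_iff (hf : IsPrechain J f) (i : Fin n) (t : ℝ) :
    (f i).1 t ≠ t ↔ t ∈ J i := by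
  rw [← hf.supp_eq i]; rfl

theorem IsPrechain.nonempty_mulEquiv_higmanThompson (hf : IsPrechain J f) (hfast : IsFast J f) :
    Nonempty (generatedGroup f ≃* HigmanThompson n) := by
  obtain ⟨m, rfl⟩ : ∃ m, n = m + 1 := ⟨n - 1, by have := hf.two_le; omega⟩
  have hm : 0 < m := by have := hf.two_le; omega
  have hmem : ∀ k (hk : k ≤ m) t, (extendOne f k).1 t ≠ t ↔ t ∈ J ⟨k, Nat.lt_succ_of_le hk⟩ := by
    intro k hk t
    rw [extendOne_of_lt f (Nat.lt_succ_of_le hk), hf.apply_ne_iff]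
  rw [generatedGroup, ← extendOne_image]
  apply nonempty_closure_image_mulEquiv_higmanThompson hm (le_extendOne_apply hf.le_apply)
  · intro i k hik hk t ht
    by_contra hne
    rw [← ne_eq, hmem k hk] at hne
    rw [hmem i (by omega)] at ht
    exact Set.disjoint_left.1 (hf.chain.disjoint _ _ hik) ht hne
  · intro i hi
    obtain ⟨t, ht, ht'⟩ := Set.exists_of_ssubset
      (hf.chain.overlap ⟨i, by omega⟩ ⟨i + 1, by omega⟩ rfl).2.1
    refine ⟨t, (hmem i hi.le t).2 ht, ?_⟩
    by_contra hne
    exact ht' ⟨ht, (hmem (i + 1) hi t).1 hne⟩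
  · obtain ⟨t, ht, ht'⟩ := (hf.chain.overlap ⟨m - 1, by omega⟩ ⟨m, by omega⟩
      (Nat.sub_add_cancel hm)).1
    exact ⟨t, (hmem m le_rfl t).2 ht', (hmem (m - 1) (by omega) t).2 ht⟩
  · intro i hi j hj hjm x y hx hy
    exact hfast ⟨i, by omega⟩ ⟨j, by omega⟩ (by simpa using hi) hj x ((hmem i hi.le x).1 hx) y
      ((hmem j hjm y).1 hy)

theorem exists_forall_lt_of_leftEndpoint_lt {A B : Set ℝ} (h : leftEndpoint A < leftEndpoint B) :
    ∃ x ∈ A, ∀ y ∈ B, x < y := by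
  obtain ⟨_, ⟨x, hx, rfl⟩, hlt⟩ := sInf_lt_iff.1 h
  refine ⟨x, hx, fun y hy => EReal.coe_lt_coe_iff.1 (hlt.trans_le (sInf_le ⟨y, hy, rfl⟩))⟩

theorem lt_of_disjoint_of_leftEndpoint_lt {A B : Set ℝ} (hA : A.OrdConnected) (hd : Disjoint A B)
    (h : leftEndpoint A < leftEndpoint B) {x y : ℝ} (hx : x ∈ A) (hy : y ∈ B) : x < y := by
  obtain ⟨a, ha, hlt⟩ := exists_forall_lt_of_leftEndpoint_lt h
  by_contra! hle
  exact Set.disjoint_left.1 hd (hA.out ha hx ⟨(hlt y hy).le, hle⟩) hy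

theorem IsPrechain.leftEndpoint_lt (hf : IsPrechain J f) {i k : Fin n} (hik : i < k) :
    leftEndpoint (J i) < leftEndpoint (J k) := by
  obtain ⟨k, hk⟩ := k
  replace hik : (i : ℕ) + 1 ≤ k := hik
  induction k, hik using Nat.le_induction with
  | base => exact hf.left_lt _ _ rfl
  | succ k hik ih => exact (ih (by omega)).trans (hf.left_lt ⟨k, by omega⟩ ⟨k + 1, hk⟩ rfl)

theorem IsPrechain.lt_of_mem (hf : IsPrechain J f) {i k : Fin n} (hik : (i : ℕ) + 1 < k)
    {x y : ℝ} (hx : x ∈ J i) (hy : y ∈ J k) : x < y :=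
  lt_of_disjoint_of_leftEndpoint_lt (hf.chain.ordConnected i) (hf.chain.disjoint i k hik)
    (hf.leftEndpoint_lt (Fin.lt_def.2 (by omega))) hx hy

theorem IsPrechain.exists_lt (hf : IsPrechain J f) (i : Fin n) (hi : (i : ℕ) + 1 < n) :
    ∃ a ∈ J i, ∀ j, i < j → ∀ y ∈ J j, a < y := by
  obtain ⟨a, ha, hlt⟩ :=
    exists_forall_lt_of_leftEndpoint_lt (hf.left_lt i ⟨i + 1, hi⟩ rfl)
  refine ⟨a, ha, fun j hj y hy => ?_⟩
  rcases (by have := Fin.lt_def.1 hj; omega : (j : ℕ) = i + 1 ∨ (i : ℕ) + 1 < j) with h | h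
  · obtain rfl : j = ⟨i + 1, hi⟩ := Fin.ext h
    exact hlt y hy
  · exact hf.lt_of_mem h ha hy

/-- A point of J_k outside J_{k-1} must lie to its right, because J_{k-1} is convex and contains a
point left of all of J_k. -/
theorem IsPrechain.exists_gt (hf : IsPrechain J f) (k : Fin n) (hk : 0 < (k : ℕ)) :
    ∃ b ∈ J k, ∀ i, i < k → ∀ x ∈ J i, x < b := by
  obtain ⟨b, hb, hb'⟩ := Set.exists_of_ssubset
    (hf.chain.overlap ⟨k - 1, by omega⟩ k (Nat.sub_add_cancel hk)).2.2
  refine ⟨b, hb, fun i hi x hx => ?_⟩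
  rcases (by have := Fin.lt_def.1 hi; omega : (i : ℕ) + 1 = k ∨ (i : ℕ) + 1 < k) with h | h
  · have hik : ⟨k - 1, by omega⟩ = i := Fin.ext (by simp; omega)
    rw [hik] at hb'
    obtain ⟨a, ha, hlt⟩ := exists_forall_lt_of_leftEndpoint_lt (hf.left_lt i k h)
    by_contra! hle
    exact hb' ⟨(hf.chain.ordConnected _).out ha hx ⟨(hlt b hb).le, hle⟩, hb⟩
  · exact hf.lt_of_mem h hx hb

end Prechain

/-! ### Large powers are fast -/

section Powers

open Filter

theorem pow_val_apply (f : HomeoPlus) (N : ℕ) (x : ℝ) : (f ^ N).1 x = f.1^[N] x := by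
  induction N with
  | zero => rfl
  | succ N ih => rw [pow_succ', mul_val_apply, ih, Function.iterate_succ_apply']

theorem monotone_pow_apply {f : HomeoPlus} (hf : ∀ t, t ≤ f.1 t) (x : ℝ) :
    Monotone fun N : ℕ => (f ^ N).1 x :=
  monotone_nat_of_le_succ fun N => by
    rw [pow_succ', mul_val_apply]
    exact hf _

theorem le_pow_apply {f : HomeoPlus} (hf : ∀ t, t ≤ f.1 t) (N : ℕ) (x : ℝ) :
    x ≤ (f ^ N).1 x := monotone_pow_apply hf x N.zero_le

theorem supp_pow {f : HomeoPlus} (hf : ∀ t, t ≤ f.1 t) {N : ℕ} (hN : 1 ≤ N) :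
    supp (f ^ N) = supp f := by
  ext x
  refine not_congr ⟨fun h => le_antisymm ?_ (hf x), fun h => ?_⟩
  · have := monotone_pow_apply hf x hN
    simp only [pow_one] at this
    exact this.trans_eq h
  · rw [pow_val_apply]
    exact Function.iterate_fixed h N

/-- Powers of a homeomorphism push each point of a component of its support beyond any other. -/
theorem eventually_le_pow_apply {f : HomeoPlus} (hf : ∀ t, t ≤ f.1 t)
    (hJ : (supp f).OrdConnected) {x z : ℝ} (hx : x ∈ supp f) (hz : z ∈ supp f) :
    ∀ᶠ N : ℕ in atTop, z ≤ (f ^ N).1 x := by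
  have hmono := monotone_pow_apply hf x
  by_cases hex : ∃ N₀ : ℕ, z ≤ (f ^ N₀).1 x
  · obtain ⟨N₀, h₀⟩ := hex
    exact eventually_atTop.2 ⟨N₀, fun N hN => h₀.trans (hmono hN)⟩
  · push Not at hex
    have hbdd : BddAbove (Set.range fun N : ℕ => (f ^ N).1 x) :=
      ⟨z, by rintro _ ⟨N, rfl⟩; exact (hex N).le⟩
    have ht := tendsto_atTop_ciSup hmono hbdd
    simp only [pow_val_apply] at ht hbdd hex
    have hfix := isFixedPt_of_tendsto_iterate ht f.1.continuous.continuousAt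
    -- A bounded orbit converges to a fixed point between x and z, but convexity puts that point in
    -- the support.
    have hmem : (⨆ N : ℕ, f.1^[N] x) ∈ supp f :=
      hJ.out hx hz ⟨le_ciSup hbdd 0, ciSup_le fun N => (hex N).le⟩
    exact absurd hfix hmem

variable {n : ℕ} {J : Fin n → Set ℝ} {f : Fin n → HomeoPlus}

theorem IsPrechain.pow (hf : IsPrechain J f) {N : ℕ} (hN : 1 ≤ N) :
    IsPrechain J fun i => f i ^ N where
  two_le := hf.two_le
  chain := hf.chain
  left_lt := hf.left_lt
  supp_eq i := (supp_pow (hf.le_apply i) hN).trans (hf.supp_eq i)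
  le_apply i := le_pow_apply (hf.le_apply i) N

/-- A relay: each power pushes the point into the overlap with the next interval, where the next
power takes over. -/
theorem IsPrechain.eventually_le_prefixProd (hf : IsPrechain J f) (h0 : 0 < n) {a : ℝ}
    (ha : a ∈ J ⟨0, h0⟩) (k : ℕ) (hk : k < n) {z : ℝ} (hz : z ∈ J ⟨k, hk⟩) :
    ∀ᶠ N : ℕ in atTop, z ≤ (prefixProd (extendOne fun i => f i ^ N) (k + 1)).1 a := by
  have hpush : ∀ (i : Fin n) {x z : ℝ}, x ∈ J i → z ∈ J i →
      ∀ᶠ N : ℕ in atTop, z ≤ (f i ^ N).1 x := by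
    intro i x z hx hz
    rw [← hf.supp_eq i] at hx hz
    exact eventually_le_pow_apply (hf.le_apply i)
      (by rw [hf.supp_eq]; exact hf.chain.ordConnected i) hx hz
  induction k generalizing z with
  | zero =>
    filter_upwards [hpush _ ha hz] with N hN
    rwa [prefixProd_succ, extendOne_of_lt _ h0, mul_val_apply]
  | succ k ih =>
    obtain ⟨w, hw, hw'⟩ := (hf.chain.overlap ⟨k, by omega⟩ ⟨k + 1, hk⟩ rfl).1
    filter_upwards [ih (by omega) hw, hpush _ hw' hz] with N h1 h2
    rw [prefixProd_succ, extendOne_of_lt _ hk, mul_val_apply]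
    exact h2.trans ((strictMono_val _).monotone h1)

/-- One inequality b ≤ P a suffices, with a ∈ J_0 left of all later intervals and b ∈ J_m right of
all earlier ones. -/
theorem IsPrechain.eventually_isFast (hf : IsPrechain J f) :
    ∀ᶠ N : ℕ in atTop, IsFast J fun i => f i ^ N := by
  obtain ⟨m, rfl⟩ : ∃ m, n = m + 1 := ⟨n - 1, by have := hf.two_le; omega⟩
  have hm : 0 < m := by have := hf.two_le; omega
  obtain ⟨a, ha, hlt⟩ := hf.exists_lt ⟨0, by omega⟩ (by simpa using hm)
  obtain ⟨b, hb, hgt⟩ := hf.exists_gt ⟨m, by omega⟩ hm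
  filter_upwards [hf.eventually_le_prefixProd (by omega) ha m (by omega) hb] with N hN
  intro i j hi hj x hx y hy
  calc x < b := hgt i (Fin.lt_def.2 (by simpa using hi)) x hx
    _ ≤ _ := hN
    _ < _ := strictMono_val _ (hlt j (Fin.lt_def.2 hj) y hy)

theorem IsPrechain.pair (hf : IsPrechain J f) {i k : Fin n} (hik : (i : ℕ) + 1 = k) :
    IsPrechain ![J i, J k] ![f i, f k] where
  two_le := le_rfl
  chain :=
    { nonempty := Fin.forall_fin_two.2 ⟨hf.chain.nonempty i, hf.chain.nonempty k⟩
      isOpen := Fin.forall_fin_two.2 ⟨hf.chain.isOpen i, hf.chain.isOpen k⟩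
      ordConnected := Fin.forall_fin_two.2 ⟨hf.chain.ordConnected i, hf.chain.ordConnected k⟩
      disjoint := fun a b h => by omega
      overlap := fun a b h => by
        obtain rfl : a = 0 := Fin.ext (by simp; omega)
        obtain rfl : b = 1 := Fin.ext (by simpa using h.symm)
        exact hf.chain.overlap i k hik }
  left_lt a b h := by
    obtain rfl : a = 0 := Fin.ext (by simp; omega)
    obtain rfl : b = 1 := Fin.ext (by simpa using h.symm)
    exact hf.left_lt i k hik
  supp_eq := Fin.forall_fin_two.2 ⟨hf.supp_eq i, hf.supp_eq k⟩
  le_apply := Fin.forall_fin_two.2 ⟨hf.le_apply i, hf.le_apply k⟩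

end Powers

/-! ### Thompson's group F as a fast 2-prechain -/

section Thompson

theorem thompsonA_apply (x : ℝ) : thompsonA.1 x = x + 1 := rfl

theorem thompsonB_apply (x : ℝ) : thompsonB.1 x = bFun x := rfl

/-- Applying b to both sides avoids computing b⁻¹. -/
theorem le_thompsonB_inv_mul_iff {x : ℝ} : x ≤ (thompsonB⁻¹ * thompsonA).1 x ↔ bFun x ≤ x + 1 := by
  rw [← (strictMono_val thompsonB).le_iff_le, mul_val_apply, apply_inv_apply, thompsonA_apply,
    thompsonB_apply]

theorem thompsonB_inv_mul_eq_iff {x : ℝ} : (thompsonB⁻¹ * thompsonA).1 x = x ↔ x + 1 = bFun x := by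
  rw [← (strictMono_val thompsonB).injective.eq_iff, mul_val_apply, apply_inv_apply,
    thompsonA_apply, thompsonB_apply]

theorem supp_thompsonB_inv_mul : supp (thompsonB⁻¹ * thompsonA) = Set.Iio 1 := by
  ext x
  refine (not_congr thompsonB_inv_mul_eq_iff).trans ?_
  rw [Set.mem_Iio, bFun]
  split_ifs <;> constructor <;> intro h <;>
    first | linarith | exact absurd rfl h

theorem supp_thompsonB : supp thompsonB = Set.Ioi 0 := by
  ext x
  rw [Set.mem_Ioi, supp, Set.mem_ofPred_eq, thompsonB_apply, bFun]
  split_ifs <;> constructor <;> intro h <;>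
    first | linarith | exact absurd rfl h

theorem isPrechain_thompson :
    IsPrechain ![Set.Iio (1 : ℝ), Set.Ioi 0] ![thompsonB⁻¹ * thompsonA, thompsonB] where
  two_le := le_rfl
  chain :=
    { nonempty := Fin.forall_fin_two.2 ⟨Set.nonempty_Iio, Set.nonempty_Ioi⟩
      isOpen := Fin.forall_fin_two.2 ⟨isOpen_Iio, isOpen_Ioi⟩
      ordConnected := Fin.forall_fin_two.2 ⟨Set.ordConnected_Iio, Set.ordConnected_Ioi⟩
      disjoint := fun a b h => by omega
      overlap := fun a b h => by
        obtain rfl : a = 0 := Fin.ext (by simp; omega)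
        obtain rfl : b = 1 := Fin.ext (by simpa using h.symm)
        refine ⟨⟨1 / 2, ?_, ?_⟩, ⟨Set.inter_subset_left, fun h => ?_⟩,
          ⟨Set.inter_subset_right, fun h => ?_⟩⟩
        · change (1 / 2 : ℝ) < 1; norm_num
        · change (0 : ℝ) < 1 / 2; norm_num
        · exact lt_irrefl (0 : ℝ) (h (show (0 : ℝ) < 1 from one_pos)).2
        · exact lt_irrefl (1 : ℝ) (h (show (0 : ℝ) < 1 from one_pos)).1 }
  left_lt a b h := by
    obtain rfl : a = 0 := Fin.ext (by simp; omega)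
    obtain rfl : b = 1 := Fin.ext (by simpa using h.symm)
    have h1 : leftEndpoint (Set.Iio 1) ≤ ((-1 : ℝ) : EReal) :=
      sInf_le ⟨-1, by simp, rfl⟩
    have h2 : ((0 : ℝ) : EReal) ≤ leftEndpoint (Set.Ioi 0) := by
      refine le_sInf ?_
      rintro _ ⟨y, hy, rfl⟩
      exact EReal.coe_le_coe_iff.2 (le_of_lt hy)
    exact h1.trans_lt ((EReal.coe_lt_coe_iff.2 (by norm_num)).trans_le h2)
  supp_eq := Fin.forall_fin_two.2 ⟨supp_thompsonB_inv_mul, supp_thompsonB⟩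
  le_apply := by
    refine Fin.forall_fin_two.2 ⟨fun t => le_thompsonB_inv_mul_iff.2 ?_, fun t => ?_⟩
    · rw [bFun]; split_ifs <;> linarith
    · change t ≤ bFun t
      rw [bFun]; split_ifs <;> linarith

/-- The total product b · (b⁻¹a) is the translation a, whose step 1 is the length of the overlap (0,
1). -/
theorem isFast_thompson :
    IsFast ![Set.Iio (1 : ℝ), Set.Ioi 0] ![thompsonB⁻¹ * thompsonA, thompsonB] := by
  intro a b ha hb x hx y hy
  obtain rfl : a = 0 := Fin.ext (by simp; omega)
  obtain rfl : b = 1 := Fin.ext (by simp; omega)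
  have hx : x < 1 := hx
  have hy : 0 < y := hy
  have : prefixProd (extendOne ![thompsonB⁻¹ * thompsonA, thompsonB]) 2 = thompsonA := by
    change thompsonB * ((thompsonB⁻¹ * thompsonA) * 1) = thompsonA
    group
  rw [this, thompsonA_apply]
  linarith

theorem generatedGroup_pair (f g : HomeoPlus) :
    generatedGroup ![f, g] = Subgroup.closure {f, g} := by
  rw [generatedGroup, Matrix.range_cons_cons_empty]

theorem closure_thompsonB_inv_mul :
    Subgroup.closure {thompsonB⁻¹ * thompsonA, thompsonB} = ThompsonF := by
  have hA : thompsonA ∈ Subgroup.closure {thompsonB⁻¹ * thompsonA, thompsonB} := by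
    have := mul_mem (Subgroup.subset_closure (by simp) :
      thompsonB ∈ Subgroup.closure {thompsonB⁻¹ * thompsonA, thompsonB})
      (Subgroup.subset_closure (by simp) :
      thompsonB⁻¹ * thompsonA ∈ Subgroup.closure {thompsonB⁻¹ * thompsonA, thompsonB})
    rwa [mul_inv_cancel_left] at this
  apply le_antisymm
  · rw [Subgroup.closure_le]
    rintro _ (rfl | rfl)
    · exact mul_mem (inv_mem (Subgroup.subset_closure (by simp)))
        (Subgroup.subset_closure (by simp))
    · exact Subgroup.subset_closure (by simp)
  · rw [ThompsonF, Subgroup.closure_le]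
    rintro _ (rfl | rfl)
    · exact hA
    · exact Subgroup.subset_closure (by simp)

/-- Thompson's group `F` is the Higman–Thompson group `F_2`. -/
theorem nonempty_thompsonF_mulEquiv : Nonempty (ThompsonF ≃* HigmanThompson 2) := by
  rw [← closure_thompsonB_inv_mul, ← generatedGroup_pair]
  exact isPrechain_thompson.nonempty_mulEquiv_higmanThompson isFast_thompson

theorem IsPrechain.eventually_adjacent {n : ℕ} {J : Fin n → Set ℝ} {f : Fin n → HomeoPlus}
    (hf : IsPrechain J f) {i k : Fin n} (hik : (i : ℕ) + 1 = k) :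
    ∀ᶠ N : ℕ in Filter.atTop, Nonempty (Subgroup.closure {f i ^ N, f k ^ N} ≃* ThompsonF) := by
  filter_upwards [(hf.pair hik).eventually_isFast, Filter.eventually_ge_atTop 1] with N hN h1
  obtain ⟨e⟩ := ((hf.pair hik).pow h1).nonempty_mulEquiv_higmanThompson hN
  obtain ⟨e'⟩ := nonempty_thompsonF_mulEquiv
  have : (fun j => ![f i, f k] j ^ N) = ![f i ^ N, f k ^ N] := by
    funext j
    fin_cases j <;> rfl
  rw [this, generatedGroup_pair] at e
  exact ⟨e.trans e'.symm⟩

end Thompson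

end ChainGroup

theorem theorem1p1 {n : ℕ} (J : Fin n → Set ℝ) (f : Fin n → ChainGroup.HomeoPlus)
    (hf : ChainGroup.IsPrechain J f) :
    ∃ N₀ : ℕ, ∀ N : ℕ, N₀ ≤ N →
      ChainGroup.IsChain J (fun i => f i ^ N) ∧
      Nonempty (ChainGroup.generatedGroup (fun i => f i ^ N) ≃* ChainGroup.HigmanThompson n) := by
  rw [← Filter.eventually_atTop]
  have hadj : ∀ᶠ N : ℕ in Filter.atTop, ∀ i k : Fin n, (i : ℕ) + 1 = k →
      Nonempty (Subgroup.closure {f i ^ N, f k ^ N} ≃* ChainGroup.ThompsonF) := by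
    simp only [Filter.eventually_all]
    exact fun i k hik => hf.eventually_adjacent hik
  -- N ≥ 1 is needed because the zeroth powers have empty support.
  filter_upwards [hf.eventually_isFast, hadj, Filter.eventually_ge_atTop 1] with N h1 h2 h3
  exact ⟨{ hf.pow h3 with adjacent := h2 }, (hf.pow h3).nonempty_mulEquiv_higmanThompson h1⟩
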